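/- Let $\mathcal A=\{H_1,\dots,H_l\}$ be an arrangement of $l$ distinct hyperplanes in $\mathbb{CP}^n$, with $H_i$ defined by the nonzero linear form $\alpha_i$. Let $E$ be the exterior algebra of $\mathbb C^l$ with canonical generators $x_1,\dots,x_l$, and let $A=E/K$ be the Orlik–Solomon algebra of $\mathcal A$, where $K$ is the two-sided ideal generated by the elements $$\partial(x_{i_1}\wedge\cdots\wedge x_{i_m})=\sum_{j=1}^m(-1)^j\,x_{i_1}\wedge\cdots\wedge x_{i_{j-1}}\wedge x_{i_{j+1}}\wedge\cdots\wedge x_{i_m}$$ for all distinct $i_1,\dots,i_m$ such that $H_{i_1},\dots,H_{i_m}$ intersect non-generically (that is, $\alpha_{i_1},\dots,\alpha_{i_m}$ are linearly dependent), together with the monomials $x_{i_1}\wedge\cdots\wedge x_{i_m}$ for all distinct $i_1,\dots,i_m$ with $H_{i_1}\cap\cdots\cap H_{i_m}=\emptyset$ in $\mathbb{CP}^n$. Let $M=(a_{ri})$ be an $n\times l$ complex matrix with columns $v_1,\dots,v_l\in\mathbb C^n$, and let $w_r=\sum_{i=1}^l a_{ri}x_i\in A$ for $r=1,\dots,n$.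 A flat of $\mathcal A$ is a nonempty subspace of $\mathbb{CP}^n$ that is the intersection of some of the hyperplanes of $\mathcal A$; for a flat $S$ put $v_S=\sum_{H_i\supseteq S}v_i$. Then $w_1\wedge\cdots\wedge w_n=0$ in $A$ if and only if, for every flag $S_1\supseteq\cdots\supseteq S_n$ of flats of $\mathcal A$, the vectors $v_{S_1},\dots,v_{S_n}$ span a subspace of $\mathbb C^n$ of dimension less than $n$ (the "flag condition"). -/

import Mathlib

open scoped LinearAlgebra.Projectivization

noncomputable section

/-- The complex projective space of dimension `n`. -/
abbrev CPn (n : ℕ) : Type := ℙ ℂ (Fin (n + 1) → ℂ)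

/-- The zero locus in projective space of a linear form in the homogeneous coordinates. -/
def zeroLocus {n : ℕ} (α : Module.Dual ℂ (Fin (n + 1) → ℂ)) : Set (CPn n) :=
  {p | p.submodule ≤ LinearMap.ker α}

/-- An arrangement of `l` distinct hyperplanes in the complex projective space of dimension `n`;
the `i`-th hyperplane is the zero locus of the nonzero linear form `form i`. -/
structure HyperplaneArrangement (n l : ℕ) where
  form : Fin l → Module.Dual ℂ (Fin (n + 1) → ℂ)
  form_ne_zero : ∀ i, form i ≠ 0
  distinct : Function.Injective fun i => zeroLocus (form i)

namespace HyperplaneArrangement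

variable {n l : ℕ} (A : HyperplaneArrangement n l)

/-- The `i`-th hyperplane, as a set of points of projective space. -/
def hyperplane (i : Fin l) : Set (CPn n) := zeroLocus (A.form i)

/-- The generator `x_i` of the exterior algebra on `ℂ^l`. -/
def x (i : Fin l) : ExteriorAlgebra ℂ (Fin l → ℂ) :=
  ExteriorAlgebra.ι ℂ (Pi.single i (1 : ℂ))

/-- The monomial `x_{i_1} ∧ ⋯ ∧ x_{i_m}`. -/
def monomial {m : ℕ} (i : Fin m → Fin l) : ExteriorAlgebra ℂ (Fin l → ℂ) :=
  (List.ofFn fun j => x (i j)).prod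

/-- The element `∂(x_{i_1} ∧ ⋯ ∧ x_{i_m})` for `m = k + 1 ≥ 1`, that is, the sum over `1 ≤ j ≤ m`
of `(-1)^j` times the monomial with its `j`-th factor removed (`j` is counted from `0` here). -/
def boundary {k : ℕ} (i : Fin (k + 1) → Fin l) : ExteriorAlgebra ℂ (Fin l → ℂ) :=
  ∑ j : Fin (k + 1), (-1 : ℂ) ^ ((j : ℕ) + 1) • monomial fun t => i (j.succAbove t)

/-- The hyperplanes with the given indices intersect non generically: their defining linear forms
are linearly dependent. -/
def NonGeneric {m : ℕ} (i : Fin m → Fin l) : Prop :=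
  ¬ LinearIndependent ℂ fun j => A.form (i j)

/-- The generators of the Orlik–Solomon ideal: the elements `∂(x_{i_1} ∧ ⋯ ∧ x_{i_m})` for distinct
hyperplanes that intersect non generically, and the monomials `x_{i_1} ∧ ⋯ ∧ x_{i_m}` for distinct
hyperplanes without a common point in projective space. -/
def relators : Set (ExteriorAlgebra ℂ (Fin l → ℂ)) :=
  {e | ∃ (k : ℕ) (i : Fin (k + 1) → Fin l),
      Function.Injective i ∧ A.NonGeneric i ∧ e = boundary i} ∪
  {e | ∃ (m : ℕ) (i : Fin m → Fin l),
      Function.Injective i ∧ (⋂ j, A.hyperplane (i j)) = ∅ ∧ e = monomial i}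

/-- The Orlik–Solomon ideal, a two-sided ideal of the exterior algebra. -/
def osIdeal : TwoSidedIdeal (ExteriorAlgebra ℂ (Fin l → ℂ)) :=
  TwoSidedIdeal.span A.relators

/-- The Orlik–Solomon algebra. -/
abbrev OSAlgebra : Type := A.osIdeal.ringCon.Quotient

/-- The class of `x_i` in the Orlik–Solomon algebra. -/
def gen (i : Fin l) : A.OSAlgebra := A.osIdeal.ringCon.mk' (x i)

/-- A flat of the arrangement: a nonempty intersection of some of its hyperplanes. -/
def IsFlat (S : Set (CPn n)) : Prop :=
  S.Nonempty ∧ ∃ I : Set (Fin l), S = ⋂ i ∈ I, A.hyperplane i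

/-- A flag `S_1 ⊇ ⋯ ⊇ S_m` of flats. -/
def IsFlag {m : ℕ} (S : Fin m → Set (CPn n)) : Prop :=
  (∀ k, A.IsFlat (S k)) ∧ Antitone S

open Classical in
/-- The decoration `v_S` of a flat `S` by the sum of the columns of `M` that belong to the
hyperplanes containing `S`. -/
def decoration {m : ℕ} (M : Matrix (Fin m) (Fin l) ℂ) (S : Set (CPn n)) : Fin m → ℂ :=
  ∑ i : Fin l with S ⊆ A.hyperplane i, M.col i

end HyperplaneArrangement

end

/-!
A flag `S` of length `m` sends each generator `x_j` to the 0-1 vector recording which members of `S`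
lie in the `j`-th hyperplane. Hyperplanes with distinct such vectors have independent forms, because
the members of `S` are nested; hence the relations of the Orlik–Solomon algebra `A` are respected,
and there is an induced homomorphism from `A` to the exterior algebra of `ℂ^m`. It sends
`w_1 ∧ ⋯ ∧ w_m` to the exterior product of the rows of the matrix with columns `v_{S_k}`.

Conversely, `A` is spanned in degree `m` by the monomials of its no-broken-circuit tuples. The
successive intersections of the hyperplanes of such a tuple form a flag, unless their common
intersection is empty and the monomial is zero anyway, and the homomorphism of this flag detects the
given monomial and kills all the other no-broken-circuit monomials of degree `m`. So an element of
degree `m` that is killed by the homomorphisms of all flags of length `m` vanishes.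
-/

section ExteriorPowers

theorem sum_neg_one_pow_smul_map_removeNth_of_not_injective {R M N : Type*} [CommRing R]
    [AddCommGroup M] [Module R M] [AddCommGroup N] [Module R N] {k : ℕ} (f : M [⋀^Fin k]→ₗ[R] N)
    {v : Fin (k + 1) → M} (hv : ¬ Function.Injective v) :
    ∑ j : Fin (k + 1), (-1 : ℤ) ^ (j : ℕ) • f (j.removeNth v) = 0 := by
  -- Adjoining a coordinate equal to `1` to every `v j` turns the sum into an alternating map.
  let g : R × M →ₗ[R] (R × M) [⋀^Fin k]→ₗ[R] N :=
    (LinearMap.fst R R M).smulRight (f.compLinearMap (LinearMap.snd R R M))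
  have hg := (AlternatingMap.alternatizeUncurryFin g).map_eq_zero_of_not_injective
    (fun j => (1, v j)) fun h => hv fun a b hab => h (Prod.ext rfl hab)
  simp only [AlternatingMap.alternatizeUncurryFin_apply, g, LinearMap.smulRight_apply,
    LinearMap.fst_apply, one_smul] at hg
  exact hg

theorem ιMulti_ne_zero_iff_linearIndependent {K V : Type*} [Field K] [AddCommGroup V] [Module K V]
    {m : ℕ} {v : Fin m → V} : ExteriorAlgebra.ιMulti K m v ≠ 0 ↔ LinearIndependent K v := by
  refine ⟨fun h => ?_, fun h h0 => ?_⟩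
  · contrapose! h
    exact AlternatingMap.map_linearDependent _ _ h
  · refine (exteriorPower.ιMulti_family_linearIndependent_field m h).ne_zero
      (Set.powersetCard.ofFinEmbEquiv (RelEmbedding.refl _)) (Subtype.ext ?_)
    rw [exteriorPower.ιMulti_family, Equiv.symm_apply_apply, exteriorPower.ιMulti_apply_coe]
    exact h0

end ExteriorPowers

section Incidence

variable {K V κ : Type*} [DivisionRing K] [AddCommGroup V] [Module K V]

/-- The 0-1 vector recording which members of a family of subspaces contain a given vector. -/
noncomputable def incidence (X : κ → Submodule K V) (v : V) : κ → K :=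
  fun k => (X k : Set V).indicator 1 v

variable {X : κ → Submodule K V}

theorem incidence_apply_of_mem {v : V} {k : κ} (h : v ∈ X k) : incidence X v k = 1 :=
  Set.indicator_of_mem (s := (X k : Set V)) h 1

theorem incidence_apply_of_notMem {v : V} {k : κ} (h : v ∉ X k) : incidence X v k = 0 :=
  Set.indicator_of_notMem (s := (X k : Set V)) h 1

theorem incidence_eq_incidence_iff {v w : V} :
    incidence X v = incidence X w ↔ ∀ k, v ∈ X k ↔ w ∈ X k := by
  rw [funext_iff]
  refine forall_congr' fun k => ?_
  by_cases hv : v ∈ X k <;> by_cases hw : w ∈ X k <;>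
    simp [incidence_apply_of_mem, incidence_apply_of_notMem, hv, hw]

theorem incidence_ne_zero_iff {v : V} : incidence X v ≠ 0 ↔ ∃ k, v ∈ X k := by
  simp [incidence, funext_iff]

theorem linearIndependent_of_injective_incidence {ι : Type*} [LinearOrder κ] (hX : Monotone X)
    {φ : ι → V} (hφ : ∀ j, φ j ≠ 0) (hinj : Function.Injective fun j => incidence X (φ j)) :
    LinearIndependent K φ := by
  classical
  let level (j : ι) : UpperSet κ := ⟨{k | φ j ∈ X k}, fun _ _ hab h => hX hab h⟩
  rw [linearIndependent_iff_finset_linearIndependent]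
  intro s
  change LinearIndepOn K φ (s : Set ι)
  induction s using Finset.induction_on_max_value level with
  | empty => simp
  | insert a s ha hmax ih =>
    rw [Finset.coe_insert]
    refine ih.insert fun hspan => ?_
    obtain rfl | hs := s.eq_empty_or_nonempty
    · exact hφ a (by simpa using hspan)
    · obtain ⟨j, hj, hjmax⟩ := s.exists_max_image level hs
      obtain ⟨k, hk, hka⟩ : ∃ k, φ j ∈ X k ∧ φ a ∉ X k := by
        by_contra! hja
        exact ne_of_mem_of_not_mem hj ha
          (hinj (incidence_eq_incidence_iff.2 fun k => ⟨hja k, fun h => hmax j hj h⟩))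
      refine hka (Submodule.span_le.2 ?_ hspan)
      rintro _ ⟨j', hj', rfl⟩
      exact hjmax j' hj' hk

theorem linearIndependent_incidence_comp_equiv_iff {ι κ' : Type*} (e : κ' ≃ κ) {φ : ι → V} :
    LinearIndependent K (fun j => incidence (X ∘ e) (φ j)) ↔
      LinearIndependent K fun j => incidence X (φ j) :=
  LinearMap.linearIndependent_iff (v := fun j => incidence X (φ j)) (LinearMap.funLeft K K e)
    (LinearMap.ker_eq_bot.2 (LinearMap.funLeft_injective_of_surjective K K e e.surjective))

end Incidence

section TailSpan

variable {K V : Type*} [DivisionRing K] [AddCommGroup V] [Module K V] {m : ℕ}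

variable (K) in
/-- The span of the entries of a tuple from a given position on. -/
def tailSpan (φ : Fin m → V) (t : Fin m) : Submodule K V :=
  Submodule.span K (φ '' Set.Ici t)

theorem tailSpan_antitone (φ : Fin m → V) : Antitone (tailSpan K φ) :=
  fun _ _ h => Submodule.span_mono (Set.image_mono (Set.Ici_subset_Ici.2 h))

theorem mem_tailSpan (φ : Fin m → V) {s t : Fin m} (h : t ≤ s) : φ s ∈ tailSpan K φ t :=
  Submodule.subset_span (Set.mem_image_of_mem φ h)

theorem notMem_tailSpan {φ : Fin m → V} (hφ : LinearIndependent K φ) {s t : Fin m} (h : s < t) :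
    φ s ∉ tailSpan K φ t :=
  hφ.notMem_span_image (by simpa using h)

theorem tailSpan_zero (φ : Fin (m + 1) → V) :
    tailSpan K φ 0 = Submodule.span K (Set.range φ) := by
  rw [tailSpan, ← bot_eq_zero, Set.Ici_bot, Set.image_univ]

theorem tailSpan_succ (φ : Fin (m + 1) → V) (t : Fin m) :
    tailSpan K φ t.succ = tailSpan K (Fin.tail φ) t := by
  rw [tailSpan, tailSpan, ← Fin.image_succ_Ici, Set.image_image]
  rfl

theorem linearIndependent_incidence_tailSpan {K V : Type*} [Field K] [AddCommGroup V] [Module K V]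
    {φ : Fin m → V} (hφ : LinearIndependent K φ) :
    LinearIndependent K fun s => incidence (tailSpan K φ) (φ s) := by
  let N : Matrix (Fin m) (Fin m) K := Matrix.of fun s => incidence (tailSpan K φ) (φ s)
  have htri : N.IsLowerTriangular := fun s t h => incidence_apply_of_notMem (notMem_tailSpan hφ h)
  have hdiag : ∀ s, N s s = 1 := fun s => incidence_apply_of_mem (mem_tailSpan φ le_rfl)
  refine Matrix.linearIndependent_rows_of_det_ne_zero (A := N) ?_
  rw [Matrix.det_of_isLowerTriangular N htri, Finset.prod_congr rfl fun s _ => hdiag s]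
  simp

end TailSpan

section NBC

variable {K V ι : Type*} [DivisionRing K] [AddCommGroup V] [Module K V] [LinearOrder ι] {f : ι → V}
  {m : ℕ}

variable (K f) in
/-- A tuple of indices is a no-broken-circuit tuple for a family of vectors `f` if the vectors it
selects are independent and each entry is the least index of a vector in the span of the vectors
selected from there on. -/
structure IsNBC (i : Fin m → ι) : Prop where
  linearIndependent : LinearIndependent K (f ∘ i)
  le : ∀ t j, f j ∈ tailSpan K (f ∘ i) t → i t ≤ j

theorem isNBC_of_fin_zero (i : Fin 0 → ι) : IsNBC K f i :=
  ⟨linearIndependent_empty_type, fun t => t.elim0⟩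

theorem IsNBC.cons {i : Fin m → ι} (hi : IsNBC K f i) {j : ι}
    (hj : f j ∉ Submodule.span K (Set.range (f ∘ i)))
    (hmin : ∀ j', f j' ∈ Submodule.span K (Set.range (f ∘ (Fin.cons j i : Fin (m + 1) → ι))) →
      j ≤ j') :
    IsNBC K f (Fin.cons j i : Fin (m + 1) → ι) where
  linearIndependent := by
    rw [Fin.comp_cons, linearIndependent_finCons]
    exact ⟨hi.linearIndependent, hj⟩
  le := by
    refine Fin.cases (fun j' hj' => ?_) fun t j' hj' => ?_
    · rw [tailSpan_zero] at hj'
      exact hmin j' hj'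
    · rw [tailSpan_succ, Fin.comp_cons, Fin.tail_cons] at hj'
      exact hi.le t j' hj'

theorem IsNBC.tail {i : Fin (m + 1) → ι} (hi : IsNBC K f i) : IsNBC K f (Fin.tail i) where
  linearIndependent := hi.linearIndependent.comp _ (Fin.succ_injective m)
  le t j hj := hi.le t.succ j (by rw [tailSpan_succ]; exact hj)

theorem IsNBC.apply_zero_eq {i i' : Fin (m + 1) → ι} (hi : IsNBC K f i) (hi' : IsNBC K f i')
    (h : ∀ s, f (i' s) ∈ tailSpan K (f ∘ i) 0) : i' 0 = i 0 := by
  have hspan : tailSpan K (f ∘ i') 0 = tailSpan K (f ∘ i) 0 := by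
    rw [tailSpan_zero] at h ⊢
    rw [tailSpan_zero]
    have := FiniteDimensional.span_of_finite K (Set.finite_range (f ∘ i))
    refine Submodule.eq_of_le_of_finrank_eq (Submodule.span_le.2 (Set.range_subset_iff.2 h)) ?_
    rw [finrank_span_eq_card hi.linearIndependent, finrank_span_eq_card hi'.linearIndependent]
  refine le_antisymm (hi'.le 0 _ ?_) (hi.le 0 _ (h 0))
  rw [hspan]
  exact mem_tailSpan (f ∘ i) le_rfl

theorem IsNBC.eq_of_injective_incidence {i i' : Fin m → ι} (hi : IsNBC K f i)
    (hi' : IsNBC K f i') (hne : ∀ s, incidence (tailSpan K (f ∘ i)) (f (i' s)) ≠ 0)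
    (hinj : Function.Injective fun s => incidence (tailSpan K (f ∘ i)) (f (i' s))) : i' = i := by
  simp only [incidence_ne_zero_iff, Function.Injective, incidence_eq_incidence_iff] at hne hinj
  induction m with
  | zero => exact Subsingleton.elim _ _
  | succ m ih =>
    have hmem (s) : f (i' s) ∈ tailSpan K (f ∘ i) 0 :=
      (hne s).elim fun t ht => tailSpan_antitone _ (Fin.zero_le t) ht
    have h0 : i' 0 = i 0 := hi.apply_zero_eq hi' hmem
    have hsucc (t : Fin m) : tailSpan K (f ∘ i) t.succ = tailSpan K (f ∘ Fin.tail i) t :=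
      tailSpan_succ _ t
    have htail : Fin.tail i' = Fin.tail i := by
      refine ih hi.tail hi'.tail (fun s => ?_) fun s s' hss' => ?_
      · by_contra! hs
        refine Fin.succ_ne_zero s (hinj (Fin.cases ?_ fun t => ?_))
        · exact iff_of_true (hmem _) (hmem _)
        · refine iff_of_false (by rw [hsucc]; exact hs t) ?_
          rw [h0]
          exact notMem_tailSpan hi.linearIndependent t.succ_pos
      · refine Fin.succ_injective m (hinj (Fin.cases (iff_of_true (hmem _) (hmem _)) fun t => ?_))
        rw [hsucc]
        exact hss' t
    rw [← Fin.cons_self_tail i', ← Fin.cons_self_tail i, h0, htail]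

end NBC

section VanishingForms

variable {n : ℕ}

theorem mk_mem_zeroLocus_iff {α : Module.Dual ℂ (Fin (n + 1) → ℂ)} {v : Fin (n + 1) → ℂ}
    (hv : v ≠ 0) : Projectivization.mk ℂ v hv ∈ zeroLocus α ↔ α v = 0 := by
  rw [zeroLocus, Set.mem_ofPred_eq, Projectivization.submodule_mk,
    Submodule.span_singleton_le_iff_mem, LinearMap.mem_ker]

/-- The space of linear forms vanishing on a set of points of projective space. -/
noncomputable def vanishingForms (S : Set (CPn n)) :
    Submodule ℂ (Module.Dual ℂ (Fin (n + 1) → ℂ)) :=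
  (⨆ p ∈ S, p.submodule).dualAnnihilator

theorem mem_vanishingForms_iff {S : Set (CPn n)} {α : Module.Dual ℂ (Fin (n + 1) → ℂ)} :
    α ∈ vanishingForms S ↔ S ⊆ zeroLocus α := by
  rw [vanishingForms, Submodule.mem_dualAnnihilator]
  exact iSup₂_le_iff (a := LinearMap.ker α)

theorem vanishingForms_antitone : Antitone (vanishingForms (n := n)) := fun _ _ h _ hα =>
  mem_vanishingForms_iff.2 (h.trans (mem_vanishingForms_iff.1 hα))

theorem vanishingForms_iInter_zeroLocus {ι : Type*} [Finite ι]
    (φ : ι → Module.Dual ℂ (Fin (n + 1) → ℂ)) :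
    vanishingForms (⋂ i, zeroLocus (φ i)) = Submodule.span ℂ (Set.range φ) := by
  refine le_antisymm (fun α hα => mem_span_of_iInf_ker_le_ker fun v hv => ?_)
    (Submodule.span_le.2 (Set.range_subset_iff.2 fun i =>
      mem_vanishingForms_iff.2 (Set.iInter_subset _ i)))
  obtain rfl | h0 := eq_or_ne v 0
  · exact zero_mem _
  · rw [LinearMap.mem_ker, ← mk_mem_zeroLocus_iff h0]
    refine mem_vanishingForms_iff.1 hα (Set.mem_iInter.2 fun i => ?_)
    rw [mk_mem_zeroLocus_iff h0]
    exact (Submodule.mem_iInf _).1 hv i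

end VanishingForms

namespace HyperplaneArrangement

variable {n l m : ℕ}

section Monomials

theorem monomial_eq_ιMulti (i : Fin m → Fin l) :
    monomial i = ExteriorAlgebra.ιMulti ℂ m fun j => Pi.single (i j) (1 : ℂ) :=
  (ExteriorAlgebra.ιMulti_apply _).symm

theorem monomial_cons (j : Fin l) (i : Fin m → Fin l) :
    monomial (Fin.cons j i : Fin (m + 1) → Fin l) = x j * monomial i := by
  simp [monomial, List.ofFn_succ]

theorem boundary_cons (j : Fin l) (i : Fin (m + 1) → Fin l) :
    boundary (Fin.cons j i : Fin (m + 2) → Fin l) = -(monomial i + x j * boundary i) := by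
  have hremove (k : Fin (m + 1)) :
      (fun t => (Fin.cons j i : Fin (m + 2) → Fin l) (k.succ.succAbove t)) =
        (Fin.cons j (fun t => i (k.succAbove t)) : Fin (m + 1) → Fin l) :=
    funext (Fin.cases (by simp) fun t => by simp)
  rw [boundary, Fin.sum_univ_succ, boundary, Finset.mul_sum, neg_add, ← Finset.sum_neg_distrib]
  simp [hremove, monomial_cons, pow_succ]

variable {V : Type*} [AddCommGroup V] [Module ℂ V] (g : (Fin l → ℂ) →ₗ[ℂ] V)

theorem map_monomial (i : Fin m → Fin l) :
    ExteriorAlgebra.map g (monomial i) =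
      ExteriorAlgebra.ιMulti ℂ m fun j => g (Pi.single (i j) 1) := by
  rw [monomial_eq_ιMulti, ExteriorAlgebra.map_apply_ιMulti]
  rfl

theorem map_boundary_of_not_injective {i : Fin (m + 1) → Fin l}
    (hi : ¬ Function.Injective fun j => g (Pi.single (i j) 1)) :
    ExteriorAlgebra.map g (boundary i) = 0 := by
  have h := sum_neg_one_pow_smul_map_removeNth_of_not_injective (ExteriorAlgebra.ιMulti ℂ m) hi
  rw [boundary, map_sum, ← neg_eq_zero, ← h, ← Finset.sum_neg_distrib]
  refine Finset.sum_congr rfl fun j _ => ?_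
  rw [map_smul, map_monomial, pow_succ, mul_neg_one, neg_smul, neg_neg, ← Int.cast_smul_eq_zsmul ℂ]
  push_cast
  rfl

theorem boundary_of_not_injective {i : Fin (m + 1) → Fin l} (hi : ¬ Function.Injective i) :
    boundary i = 0 := by
  have h := map_boundary_of_not_injective LinearMap.id (i := i) fun h =>
    hi fun a b hab => h (by simp only [hab])
  rwa [ExteriorAlgebra.map_id, AlgHom.id_apply] at h

end Monomials

variable (A : HyperplaneArrangement n l)

section Relations

/-- The quotient map onto the Orlik–Solomon algebra, as a homomorphism of `ℂ`-algebras. -/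
noncomputable def osMk : ExteriorAlgebra ℂ (Fin l → ℂ) →ₐ[ℂ] A.OSAlgebra :=
  A.osIdeal.ringCon.mkₐ ℂ

theorem osMk_x (j : Fin l) : A.osMk (x j) = A.gen j := rfl

theorem osMk_eq_zero_iff {e : ExteriorAlgebra ℂ (Fin l → ℂ)} : A.osMk e = 0 ↔ e ∈ A.osIdeal := by
  have h := TwoSidedIdeal.mem_ker (x := e) A.osIdeal.ringCon.mk'
  rw [TwoSidedIdeal.ker_ringCon_mk'] at h
  exact h.symm

theorem nonGeneric_of_not_injective {i : Fin m → Fin l} (hi : ¬ Function.Injective i) :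
    A.NonGeneric i := fun h =>
  hi fun a b hab => h.injective (by simp only [hab])

theorem nonGeneric_cons {j : Fin l} {i : Fin m → Fin l}
    (hj : A.form j ∈ Submodule.span ℂ (Set.range (A.form ∘ i))) :
    A.NonGeneric (Fin.cons j i : Fin (m + 1) → Fin l) := by
  change ¬ LinearIndependent ℂ (A.form ∘ (Fin.cons j i : Fin (m + 1) → Fin l))
  rw [Fin.comp_cons, linearIndependent_finCons]
  exact fun h => h.2 hj

theorem osMk_boundary {i : Fin (m + 1) → Fin l} (hi : A.NonGeneric i) :
    A.osMk (boundary i) = 0 := by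
  by_cases hinj : Function.Injective i
  · exact A.osMk_eq_zero_iff.2 (TwoSidedIdeal.subset_span (Or.inl ⟨m, i, hinj, hi, rfl⟩))
  · rw [boundary_of_not_injective hinj, map_zero]

theorem osMk_monomial_eq_neg_gen_mul {j : Fin l} {i : Fin (m + 1) → Fin l}
    (h : A.NonGeneric (Fin.cons j i : Fin (m + 2) → Fin l)) :
    A.osMk (monomial i) = -(A.gen j * A.osMk (boundary i)) := by
  have hb := A.osMk_boundary h
  rwa [boundary_cons, map_neg, neg_eq_zero, map_add, map_mul, osMk_x, ← eq_neg_iff_add_eq_zero]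
    at hb

theorem osMk_monomial_of_nonGeneric {i : Fin m → Fin l} (hi : A.NonGeneric i) :
    A.osMk (monomial i) = 0 := by
  rcases m with _ | m
  · exact absurd linearIndependent_empty_type hi
  · have hrep : ¬ Function.Injective (Fin.cons (i 0) i : Fin (m + 2) → Fin l) := fun h =>
      Fin.succ_ne_zero 0 (h (by simp))
    rw [A.osMk_monomial_eq_neg_gen_mul (A.nonGeneric_of_not_injective hrep), A.osMk_boundary hi,
      mul_zero, neg_zero]

theorem osMk_monomial_of_iInter_eq_empty {i : Fin m → Fin l}
    (hi : ⋂ j, A.hyperplane (i j) = ∅) : A.osMk (monomial i) = 0 := by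
  by_cases hinj : Function.Injective i
  · exact A.osMk_eq_zero_iff.2 (TwoSidedIdeal.subset_span (Or.inr ⟨m, i, hinj, hi, rfl⟩))
  · exact A.osMk_monomial_of_nonGeneric (A.nonGeneric_of_not_injective hinj)

end Relations

section Spanning

variable {X : Submodule ℂ (Module.Dual ℂ (Fin (n + 1) → ℂ))}

/-- The span of the no-broken-circuit monomials of degree `m` in the Orlik–Solomon algebra all of
whose linear forms lie in `X`. -/
def nbcSpan (m : ℕ) (X : Submodule ℂ (Module.Dual ℂ (Fin (n + 1) → ℂ))) :
    Submodule ℂ A.OSAlgebra :=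
  Submodule.span ℂ ((fun i => A.osMk (monomial i)) ''
    {i : Fin m → Fin l | IsNBC ℂ A.form i ∧ ∀ t, A.form (i t) ∈ X})

theorem nbcSpan_mono (m : ℕ) : Monotone (A.nbcSpan m) := fun _ _ h =>
  Submodule.span_mono (Set.image_mono fun _ hi => ⟨hi.1, fun t => h (hi.2 t)⟩)

theorem gen_mul_mem_nbcSpan {j : Fin l} (hj : A.form j ∈ X)
    (hmin : ∀ j', A.form j' ∈ X → j ≤ j') {a : A.OSAlgebra} (ha : a ∈ A.nbcSpan m X) :
    A.gen j * a ∈ A.nbcSpan (m + 1) X := by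
  suffices h : A.nbcSpan m X ≤ (A.nbcSpan (m + 1) X).comap (LinearMap.mulLeft ℂ (A.gen j)) from
    h ha
  refine Submodule.span_le.2 ?_
  rintro _ ⟨i, ⟨hi, hiX⟩, rfl⟩
  have hconsX : ∀ t, A.form ((Fin.cons j i : Fin (m + 1) → Fin l) t) ∈ X :=
    Fin.cases hj hiX
  rw [SetLike.mem_coe, Submodule.mem_comap, LinearMap.mulLeft_apply, ← osMk_x, ← map_mul,
    ← monomial_cons]
  by_cases hspan : A.form j ∈ Submodule.span ℂ (Set.range (A.form ∘ i))
  · rw [A.osMk_monomial_of_nonGeneric (A.nonGeneric_cons hspan)]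
    exact zero_mem _
  · refine Submodule.subset_span ⟨_, ⟨hi.cons hspan fun j' hj' => hmin j' ?_, hconsX⟩, rfl⟩
    exact Submodule.span_le.2 (Set.range_subset_iff.2 hconsX) hj'

theorem osMk_boundary_mem_nbcSpan {i : Fin (m + 1) → Fin l}
    (h : ∀ k : Fin (m + 1), A.osMk (monomial fun t => i (k.succAbove t)) ∈ A.nbcSpan m X) :
    A.osMk (boundary i) ∈ A.nbcSpan m X := by
  rw [boundary, map_sum]
  exact Submodule.sum_mem _ fun k _ => by
    rw [map_smul]
    exact Submodule.smul_mem _ _ (h k)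

theorem osMk_monomial_mem_nbcSpan (i : Fin m → Fin l) (hX : ∀ t, A.form (i t) ∈ X) :
    A.osMk (monomial i) ∈ A.nbcSpan m X := by
  induction m generalizing X with
  | zero => exact Submodule.subset_span ⟨i, ⟨isNBC_of_fin_zero i, hX⟩, rfl⟩
  | succ m ih =>
    let Y := Submodule.span ℂ (Set.range (A.form ∘ i))
    have hY : ∀ t, A.form (i t) ∈ Y := fun t => Submodule.subset_span (Set.mem_range_self t)
    obtain ⟨j, hj, hmin⟩ := Set.exists_min_image {j | A.form j ∈ Y} id (Set.toFinite _) ⟨i 0, hY 0⟩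
    refine A.nbcSpan_mono _ (Submodule.span_le.2 (Set.range_subset_iff.2 hX)) ?_
    rw [A.osMk_monomial_eq_neg_gen_mul (A.nonGeneric_cons hj)]
    exact Submodule.neg_mem _ (A.gen_mul_mem_nbcSpan hj hmin
      (A.osMk_boundary_mem_nbcSpan fun k => ih _ fun t => hY _))

theorem osMk_ιMulti_mem_nbcSpan_top (v : Fin m → Fin l → ℂ) :
    A.osMk (ExteriorAlgebra.ιMulti ℂ m v) ∈ A.nbcSpan m ⊤ := by
  have hv : v = fun r => ∑ j, v r j • Pi.single j (1 : ℂ) := funext fun r => pi_eq_sum_univ' (v r)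
  rw [hv, ← AlternatingMap.coe_multilinearMap, MultilinearMap.map_sum, map_sum]
  refine Submodule.sum_mem _ fun i _ => ?_
  rw [MultilinearMap.map_smul_univ, AlternatingMap.coe_multilinearMap, ← monomial_eq_ιMulti,
    map_smul]
  exact Submodule.smul_mem _ _ (A.osMk_monomial_mem_nbcSpan i fun _ => Submodule.mem_top)

end Spanning

section Flags

variable {A} in
theorem IsFlag.iInter_nonempty {S : Fin m → Set (CPn n)} (hS : A.IsFlag S) :
    (⋂ k, S k).Nonempty := by
  rcases m with _ | m
  · rw [Set.iInter_of_empty]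
    exact Set.univ_nonempty
  · exact (hS.1 (Fin.last m)).1.mono (Set.subset_iInter fun k => hS.2 (Fin.le_last k))

/-- The linear map sending the generator `x_j` to the 0-1 vector that records which members of the
family `S` lie in the `j`-th hyperplane. -/
noncomputable def incidenceMap (S : Fin m → Set (CPn n)) : (Fin l → ℂ) →ₗ[ℂ] Fin m → ℂ :=
  Fintype.linearCombination ℂ fun j => incidence (vanishingForms ∘ S) (A.form j)

theorem incidenceMap_single (S : Fin m → Set (CPn n)) (j : Fin l) :
    A.incidenceMap S (Pi.single j 1) = incidence (vanishingForms ∘ S) (A.form j) := by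
  rw [incidenceMap, Fintype.linearCombination_apply_single, one_smul]

theorem incidenceMap_row (S : Fin m → Set (CPn n)) (M : Matrix (Fin m) (Fin l) ℂ) (r k : Fin m) :
    A.incidenceMap S (M r) k = A.decoration M (S k) r := by
  rw [incidenceMap, Fintype.linearCombination_apply, decoration, Finset.sum_filter,
    Finset.sum_apply, Finset.sum_apply]
  refine Finset.sum_congr rfl fun j _ => ?_
  by_cases h : S k ⊆ A.hyperplane j
  · have hk : A.form j ∈ (vanishingForms ∘ S) k := mem_vanishingForms_iff.2 h
    simp [incidence_apply_of_mem hk, h]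
  · have hk : A.form j ∉ (vanishingForms ∘ S) k := fun hk => h (mem_vanishingForms_iff.1 hk)
    simp [incidence_apply_of_notMem hk, h]

theorem map_incidenceMap_rows_eq_zero_iff (S : Fin m → Set (CPn n))
    (M : Matrix (Fin m) (Fin l) ℂ) :
    ExteriorAlgebra.map (A.incidenceMap S) (ExteriorAlgebra.ιMulti ℂ m fun r => M r) = 0 ↔
      Module.finrank ℂ (Submodule.span ℂ (Set.range fun k => A.decoration M (S k))) < m := by
  let N : Matrix (Fin m) (Fin m) ℂ := Matrix.of fun k => A.decoration M (S k)
  have hcols : A.incidenceMap S ∘ (fun r => M r) = N.col :=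
    funext fun r => funext fun k => A.incidenceMap_row S M r k
  rw [ExteriorAlgebra.map_apply_ιMulti, hcols, ← not_iff_not, ← ne_eq,
    ιMulti_ne_zero_iff_linearIndependent, Matrix.linearIndependent_cols_iff_isUnit,
    ← Matrix.linearIndependent_rows_iff_isUnit, linearIndependent_iff_card_le_finrank_span,
    Fintype.card_fin, not_lt]
  rfl

theorem osIdeal_le_ker_map_incidenceMap {S : Fin m → Set (CPn n)} (hS : A.IsFlag S) :
    A.osIdeal ≤ TwoSidedIdeal.ker (ExteriorAlgebra.map (A.incidenceMap S)) := by
  refine TwoSidedIdeal.span_le.2 ?_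
  rintro _ (⟨k, i, -, hdep, rfl⟩ | ⟨r, i, -, hempty, rfl⟩) <;>
    rw [SetLike.mem_coe, TwoSidedIdeal.mem_ker]
  · refine map_boundary_of_not_injective _ fun hinj => hdep ?_
    simp only [incidenceMap_single] at hinj
    exact linearIndependent_of_injective_incidence (vanishingForms_antitone.comp hS.2)
      (fun t => A.form_ne_zero (i t)) hinj
  · obtain ⟨p, hp⟩ := hS.iInter_nonempty
    obtain ⟨t, ht⟩ : ∃ t, p ∉ A.hyperplane (i t) := by
      by_contra! h
      exact hempty.subset (Set.mem_iInter.2 h)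
    have hzero : A.incidenceMap S (Pi.single (i t) 1) = 0 := by
      rw [incidenceMap_single]
      by_contra h
      obtain ⟨k, hk⟩ := incidence_ne_zero_iff.1 h
      exact ht (mem_vanishingForms_iff.1 hk (Set.mem_iInter.1 hp k))
    rw [map_monomial]
    exact AlternatingMap.map_coord_zero _ t hzero

/-- The homomorphism from the Orlik–Solomon algebra to the exterior algebra of `ℂ^m` induced by a
flag of length `m`; it sends `gen j` to the 0-1 vector that records which members of the flag lie in
the `j`-th hyperplane. -/
noncomputable def flagMap {S : Fin m → Set (CPn n)} (hS : A.IsFlag S) :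
    A.OSAlgebra →ₐ[ℂ] ExteriorAlgebra ℂ (Fin m → ℂ) :=
  A.osIdeal.ringCon.liftₐ (ExteriorAlgebra.map (A.incidenceMap S))
    (TwoSidedIdeal.ringCon_le_iff.1 (A.osIdeal_le_ker_map_incidenceMap hS))

theorem flagMap_osMk {S : Fin m → Set (CPn n)} (hS : A.IsFlag S)
    (e : ExteriorAlgebra ℂ (Fin l → ℂ)) :
    A.flagMap hS (A.osMk e) = ExteriorAlgebra.map (A.incidenceMap S) e := rfl

/-- The flag obtained by intersecting the hyperplanes with indices in a tuple one after the other,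
starting with the last one. -/
def tailFlag (i : Fin m → Fin l) (k : Fin m) : Set (CPn n) :=
  ⋂ j ∈ i '' Set.Ici k.rev, A.hyperplane j

theorem isFlag_tailFlag {i : Fin m → Fin l} (hi : (⋂ t, A.hyperplane (i t)).Nonempty) :
    A.IsFlag (A.tailFlag i) := by
  refine ⟨fun k => ⟨hi.mono ?_, _, rfl⟩, fun k k' h => ?_⟩
  · rw [tailFlag, Set.biInter_image]
    exact Set.subset_iInter₂ fun t _ => Set.iInter_subset _ t
  · exact Set.biInter_subset_biInter_left
      (Set.image_mono (Set.Ici_subset_Ici.2 (Fin.rev_le_rev.2 h)))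

theorem vanishingForms_comp_tailFlag (i : Fin m → Fin l) :
    vanishingForms ∘ A.tailFlag i = tailSpan ℂ (A.form ∘ i) ∘ Fin.revPerm := by
  funext k
  rw [Function.comp_apply, tailFlag, Set.biInter_image, Set.biInter_eq_iInter]
  refine (vanishingForms_iInter_zeroLocus _).trans ?_
  rw [Function.comp_apply, tailSpan, Set.image_eq_range]
  rfl

theorem map_incidenceMap_tailFlag_monomial_ne_zero_iff {i i' : Fin m → Fin l}
    (hi : IsNBC ℂ A.form i) (hi' : IsNBC ℂ A.form i') :
    ExteriorAlgebra.map (A.incidenceMap (A.tailFlag i)) (monomial i') ≠ 0 ↔ i' = i := by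
  rw [map_monomial, ιMulti_ne_zero_iff_linearIndependent]
  simp only [incidenceMap_single, vanishingForms_comp_tailFlag]
  rw [linearIndependent_incidence_comp_equiv_iff]
  constructor
  · exact fun h => hi.eq_of_injective_incidence hi' h.ne_zero h.injective
  · rintro rfl
    exact linearIndependent_incidence_tailSpan hi.linearIndependent

theorem eq_zero_of_forall_flagMap_eq_zero {a : A.OSAlgebra} (ha : a ∈ A.nbcSpan m ⊤)
    (h : ∀ (S : Fin m → Set (CPn n)) (hS : A.IsFlag S), A.flagMap hS a = 0) : a = 0 := by
  obtain ⟨c, hc, rfl⟩ := (Finsupp.mem_span_image_iff_linearCombination ℂ).1 ha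
  have hnbc : ∀ i ∈ c.support, IsNBC ℂ A.form i := fun i hi => (hc hi).1
  rw [Finsupp.linearCombination_apply, Finsupp.sum] at h ⊢
  refine Finset.sum_eq_zero fun i hi => ?_
  obtain hempty | hne := (⋂ t, A.hyperplane (i t)).eq_empty_or_nonempty
  · rw [A.osMk_monomial_of_iInter_eq_empty hempty, smul_zero]
  · have hflag := h _ (A.isFlag_tailFlag hne)
    rw [map_sum, Finset.sum_eq_single_of_mem i hi, map_smul, flagMap_osMk, smul_eq_zero] at hflag
    · rw [hflag.resolve_right
        ((A.map_incidenceMap_tailFlag_monomial_ne_zero_iff (hnbc i hi) (hnbc i hi)).2 rfl),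
        zero_smul]
    · intro i' hi' hne'
      rw [map_smul, flagMap_osMk, smul_eq_zero]
      refine Or.inr (by_contra fun h0 => hne' ?_)
      exact (A.map_incidenceMap_tailFlag_monomial_ne_zero_iff (hnbc i hi) (hnbc i' hi')).1 h0

end Flags

theorem prod_ofFn_eq_osMk {M : Matrix (Fin m) (Fin l) ℂ} {w : Fin m → A.OSAlgebra}
    (hw : ∀ r, w r = ∑ i, M r i • A.gen i) :
    (List.ofFn w).prod = A.osMk (ExteriorAlgebra.ιMulti ℂ m fun r => M r) := by
  have hrow (r : Fin m) : A.osMk (ExteriorAlgebra.ι ℂ (M r)) = w r := by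
    rw [pi_eq_sum_univ' (M r), map_sum, map_sum, hw]
    exact Finset.sum_congr rfl fun i _ => by rw [map_smul, map_smul, ← osMk_x, x]
  rw [ExteriorAlgebra.ιMulti_apply, map_list_prod, List.map_ofFn, ← funext hrow]
  rfl

end HyperplaneArrangement

theorem mainTheorem1_general {m n l : ℕ} (A : HyperplaneArrangement n l)
    (M : Matrix (Fin m) (Fin l) ℂ) (w : Fin m → A.OSAlgebra)
    (hw : ∀ r, w r = ∑ i, M r i • A.gen i) :
    (List.ofFn w).prod = 0 ↔
      ∀ S : Fin m → Set (CPn n), A.IsFlag S →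
        Module.finrank ℂ (Submodule.span ℂ (Set.range fun k => A.decoration M (S k))) < m := by
  rw [A.prod_ofFn_eq_osMk hw]
  constructor
  · intro h S hS
    rw [← A.map_incidenceMap_rows_eq_zero_iff, ← A.flagMap_osMk hS, h, map_zero]
  · intro h
    refine A.eq_zero_of_forall_flagMap_eq_zero (A.osMk_ιMulti_mem_nbcSpan_top _) fun S hS => ?_
    rw [A.flagMap_osMk, A.map_incidenceMap_rows_eq_zero_iff]
    exact h S hS

theorem mainTheorem1 {n l : ℕ} (A : HyperplaneArrangement n l) (M : Matrix (Fin n) (Fin l) ℂ)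
    (w : Fin n → A.OSAlgebra) (hw : ∀ r, w r = ∑ i, M r i • A.gen i) :
    (List.ofFn w).prod = 0 ↔
      ∀ S : Fin n → Set (CPn n), A.IsFlag S →
        Module.finrank ℂ (Submodule.span ℂ (Set.range fun k => A.decoration M (S k))) < n :=
  mainTheorem1_general A M w hw
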